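/- Let $K$ be an algebraically closed field and let $\Lambda$ be a finite-dimensional $K$-algebra with a finite family of algebra generators $a_1,\dots,a_r$. (For instance $\Lambda=K\Gamma/I$ is a finite-dimensional path algebra modulo relations and the $a_i$ are the vertices and arrows of $\Gamma$.) For $d\ge 0$ let $\operatorname{mod}_d(\Lambda)$ be the affine variety of all tuples $(x_1,\dots,x_r)$ of $d\times d$ matrices over $K$ such that $a_i\mapsto x_i$ extends to a homomorphism of $K$-algebras $\Lambda\to M_d(K)$; its points correspond to $d$-dimensional left $\Lambda$-modules with a chosen $K$-basis, and its $\operatorname{GL}_d(K)$-orbits under simultaneous conjugation correspond to the isomorphism classes of such modules. A $d$-dimensional module $M$ is said to degenerate to a $d$-dimensional module $N$ if the points of $\operatorname{mod}_d(\Lambda)$ corresponding to $N$ lie in the Zariski closure of the $\operatorname{GL}_d(K)$-orbit corresponding to $M$. A module is uniserial if its submodules form a chain under inclusion. Proposition E. If $U$ and $U'$ are non-isomorphic uniserial left $\Lambda$-modules of the same finite $K$-dimension, then $U$ does not degenerate to $U'$. -/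

import Mathlib

/-- A module is uniserial if its submodules form a chain under inclusion. -/
def IsUniserial (R M : Type*) [Ring R] [AddCommGroup M] [Module R M] : Prop :=
  ∀ N P : Submodule R M, N ≤ P ∨ P ≤ N

namespace ModuleVariety

open Matrix

/-- The points of the affine space of families, indexed by `ι`, of `d × d` matrices over `K`. -/
abbrev Pt (K ι : Type*) (d : ℕ) := ι → Matrix (Fin d) (Fin d) K

/-- The list of all matrix entries of a point: its affine coordinates. -/
def coords {K ι : Type*} {d : ℕ} (x : Pt K ι d) : ι × Fin d × Fin d → K :=
  fun p => x p.1 p.2.1 p.2.2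

/-- The closure of a set of points in the Zariski topology of the affine space `Pt K ι d`:
the points at which every polynomial in the matrix entries that vanishes on `S` vanishes. -/
def zariskiClosure {K ι : Type*} [Field K] {d : ℕ} (S : Set (Pt K ι d)) : Set (Pt K ι d) :=
  {y | coords y ∈ MvPolynomial.zeroLocus K (MvPolynomial.vanishingIdeal K (coords '' S))}

/-- The variety of `d`-dimensional representations of the algebra `L` with respect to the
generators `a i` of `L`: families `x` of `d × d` matrices that satisfy all the relations
satisfied by the `a i`, i.e. for which `a i ↦ x i` extends to a homomorphism of `K`-algebras. -/
def modVariety (K : Type*) {L ι : Type*} [Field K] [Ring L] [Algebra K L] (a : ι → L) (d : ℕ) :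
    Set (Pt K ι d) :=
  {x | ∃ ρ : L →ₐ[K] Matrix (Fin d) (Fin d) K, ∀ i, ρ (a i) = x i}

/-- The orbit of `x` under the action of `GL_d` by simultaneous conjugation. -/
def orbit {K ι : Type*} [Field K] {d : ℕ} (x : Pt K ι d) : Set (Pt K ι d) :=
  {y | ∃ g : GL (Fin d) K, ∀ i,
    y i = (g : Matrix (Fin d) (Fin d) K) * x i * ((g⁻¹ : GL (Fin d) K) : Matrix _ _ K)}

/-- The point `x` corresponds to the left `L`-module `M`: the space `K ^ d`, on which `a i` acts
as the matrix `x i`, is isomorphic to `M`. -/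
def Represents {K L ι : Type*} [Field K] [Ring L] [Algebra K L] (a : ι → L) {d : ℕ}
    (x : Pt K ι d) (M : Type*) [AddCommGroup M] [Module K M] [Module L M] : Prop :=
  ∃ φ : (Fin d → K) ≃ₗ[K] M, ∀ (i : ι) (v : Fin d → K), φ (x i *ᵥ v) = a i • φ v

/-- The `L`-module `M` degenerates to the `L`-module `N`: in the variety of representations of `L`
of some dimension `d`, a point corresponding to `N` lies in the Zariski closure of the
`GL_d`-orbit of a point corresponding to `M`. -/
def Degenerates (K : Type*) {L ι : Type*} [Field K] [Ring L] [Algebra K L] (a : ι → L)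
    (M N : Type*) [AddCommGroup M] [Module K M] [Module L M]
    [AddCommGroup N] [Module K N] [Module L N] : Prop :=
  ∃ (d : ℕ) (x y : Pt K ι d), x ∈ modVariety K a d ∧ y ∈ modVariety K a d ∧
    Represents a x M ∧ Represents a y N ∧ y ∈ zariskiClosure (orbit x)

end ModuleVariety

/-! The rank of a matrix over `L` acting on a module is lower semicontinuous on the variety, so a
degeneration of `M` to `N` forces every such rank on `N` to be at most the rank on `M`
(`Degenerates.rankDominates`). For uniserial modules of equal dimension these inequalities already
give an isomorphism (`RankDominates.nonempty_linearEquiv`), by induction on dimension.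

Let `S` be a simple quotient of `M` and `I` its annihilator. A nonzero uniserial module killed by
`I` is isomorphic to `S`, so `M / IM ≅ S`. Domination passes to `IM` and `IN`, whence `IN ≠ N`, `N /
IN ≅ S`, and inductively `IM ≅ IN`. Let `u` generate `M`. If `M ≇ N`, no element outside `IN` is
killed by the annihilator of `u`. The elements it kills then form a strictly smaller space in `N`
than in `M`, whereas domination gives the opposite inequality. -/

open Module

/-! ### Uniserial modules and their simple tops -/

namespace IsUniserial

variable {R M N : Type*} [Ring R] [AddCommGroup M] [Module R M] [AddCommGroup N] [Module R N]

theorem of_injective (h : IsUniserial R M) (f : N →ₗ[R] M) (hf : Function.Injective f) :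
    IsUniserial R N := fun P Q => by
  rcases h (P.map f) (Q.map f) with h | h
  · exact Or.inl ((Submodule.map_le_map_iff_of_injective hf P Q).1 h)
  · exact Or.inr ((Submodule.map_le_map_iff_of_injective hf Q P).1 h)

theorem of_surjective (h : IsUniserial R M) (f : M →ₗ[R] N) (hf : Function.Surjective f) :
    IsUniserial R N := fun P Q => by
  rcases h (P.comap f) (Q.comap f) with h | h
  · exact Or.inl ((Submodule.comap_le_comap_iff_of_surjective hf).1 h)
  · exact Or.inr ((Submodule.comap_le_comap_iff_of_surjective hf).1 h)

/-- A nonzero module that is both uniserial and semisimple is simple. -/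
theorem isSimpleModule (h : IsUniserial R M) [Nontrivial M] [IsSemisimpleModule R M] :
    IsSimpleModule R M := by
  rw [isSimpleModule_iff]
  refine { exists_pair_ne := ⟨⊥, ⊤, bot_ne_top⟩, eq_bot_or_eq_top := fun P => ?_ }
  obtain ⟨Q, hQ⟩ := exists_isCompl P
  rcases h P Q with hPQ | hPQ
  · exact Or.inl (disjoint_self.1 (hQ.disjoint.mono_right hPQ))
  · exact Or.inr (codisjoint_self.1 (hQ.codisjoint.mono_right hPQ))

end IsUniserial

/-- A cyclic submodule of a module killed by the annihilator of a simple module `S` embeds into a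
finite power of `S`, if finitely many elements of `S` have the same annihilator as `S`. -/
theorem exists_injective_pi_of_annihilator_le {R S M : Type*} [Ring R] [AddCommGroup S] [Module R S]
    [IsSimpleModule R S] {n : ℕ} (b : Fin n → S) (hb : ∀ x : R, (∀ i, x • b i = 0) →
      x ∈ annihilator R S) [AddCommGroup M] [Module R M]
    (hM : annihilator R S ≤ annihilator R M) (m : M) :
    ∃ f : (R ∙ m) →ₗ[R] (Fin n → S), Function.Injective f := by
  let f : R →ₗ[R] (Fin n → S) := LinearMap.pi fun i => LinearMap.toSpanSingleton R S (b i)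
  let g : R →ₗ[R] M := LinearMap.toSpanSingleton R M m
  have hfg : LinearMap.ker f ≤ LinearMap.ker g := fun x hx => by
    have hx' : x ∈ annihilator R M := hM (hb x fun i => congrFun hx i)
    exact mem_annihilator.1 hx' m
  let q : LinearMap.range f →ₗ[R] M :=
    (LinearMap.ker f).liftQ g hfg ∘ₗ f.quotKerEquivRange.symm.toLinearMap
  have hq : LinearMap.range q = R ∙ m := by
    rw [LinearMap.range_comp, LinearEquiv.range, Submodule.map_top, Submodule.range_liftQ]
    exact LinearMap.range_toSpanSingleton m
  -- `range f` lies in `S ^ n`, hence is semisimple, so its quotient `R ∙ m` is also isomorphic to a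
  -- submodule of it.
  obtain ⟨P, ⟨e⟩⟩ := IsSemisimpleModule.exists_submodule_linearEquiv_quotient (LinearMap.ker q)
  let e' : (R ∙ m) ≃ₗ[R] P := (LinearEquiv.ofEq _ _ hq.symm).trans (q.quotKerEquivRange.symm.trans e.symm)
  exact ⟨(LinearMap.range f).subtype ∘ₗ P.subtype ∘ₗ e'.toLinearMap,
    (Submodule.subtype_injective _).comp ((Submodule.subtype_injective _).comp e'.injective)⟩

/-- A nonzero uniserial module killed by the annihilator of a finite-dimensional simple module
is isomorphic to it. -/
theorem IsUniserial.nonempty_linearEquiv_of_annihilator_le (K : Type*) {R S M : Type*} [Field K]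
    [Ring R] [Algebra K R] [AddCommGroup S] [Module K S] [Module R S] [IsScalarTower K R S]
    [FiniteDimensional K S] [IsSimpleModule R S] [AddCommGroup M] [Module R M] [Nontrivial M]
    (h : IsUniserial R M) (hM : annihilator R S ≤ annihilator R M) : Nonempty (M ≃ₗ[R] S) := by
  let b := finBasis K S
  have hb : ∀ x : R, (∀ i, x • b i = 0) → x ∈ annihilator R S := fun x hx => by
    rw [mem_annihilator]
    have : Algebra.lsmul K K S x = 0 := b.ext hx
    exact fun s => LinearMap.congr_fun this s
  have hss : ∀ m : M, IsSemisimpleModule R (R ∙ m) := fun m => by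
    obtain ⟨f, hf⟩ := exists_injective_pi_of_annihilator_le b hb hM m
    exact IsSemisimpleModule.of_injective f hf
  have : IsSemisimpleModule R M := by
    refine isSemisimpleModule_of_isSemisimpleModule_submodule' (p := fun m : M => R ∙ m) hss ?_
    exact eq_top_iff.2 fun m _ =>
      Submodule.mem_iSup_of_mem m (Submodule.mem_span_singleton_self m)
  have := h.isSimpleModule
  obtain ⟨m, hm⟩ := exists_ne (0 : M)
  have htop : (R ∙ m) = ⊤ := IsSimpleModule.span_singleton_eq_top R hm
  obtain ⟨f, hf⟩ := exists_injective_pi_of_annihilator_le b hb hM m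
  let f' : M →ₗ[R] (Fin (finrank K S) → S) := f ∘ₗ (LinearEquiv.ofTop _ htop).symm.toLinearMap
  have hf' : Function.Injective f' := hf.comp (LinearEquiv.ofTop _ htop).symm.injective
  have hne : f' m ≠ 0 := fun h0 => hm (hf' (h0.trans (map_zero f').symm))
  -- Schur's lemma: a nonzero coordinate of the embedding is a map between simple modules.
  obtain ⟨i, hi⟩ := Function.ne_iff.1 hne
  exact ⟨LinearEquiv.ofBijective (LinearMap.proj i ∘ₗ f')
    (LinearMap.bijective_of_ne_zero fun h0 => hi (LinearMap.congr_fun h0 m))⟩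

/-- A submodule not contained in `W` is comparable with it, hence strictly contains it, and `W` is
maximal. -/
theorem IsUniserial.span_singleton_eq_top {R M : Type*} [Ring R] [AddCommGroup M] [Module R M]
    (h : IsUniserial R M) {W : Submodule R M} (hW : IsCoatom W) {u : M} (hu : u ∉ W) :
    (R ∙ u) = ⊤ := by
  have hnle : ¬ (R ∙ u) ≤ W := fun hle => hu (hle (Submodule.mem_span_singleton_self u))
  exact hW.2 _ (lt_of_le_not_ge ((h _ _).resolve_left hnle) hnle)

namespace ModuleVariety

/-! ### Ranks of matrices over the algebra -/

section RankOrder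

variable (K : Type*) {L : Type*} [Field K] [Ring L] [Algebra K L]

/-- The `K`-linear map `M ^ p → M ^ q` given by a `q × p` matrix with entries in `L`. -/
def matrixAction (M : Type*) [AddCommGroup M] [Module K M] [Module L M] [IsScalarTower K L M]
    {p q : Type*} [Fintype p] (T : Matrix q p L) : (p → M) →ₗ[K] (q → M) :=
  LinearMap.pi fun i => ∑ j, Algebra.lsmul K K M (T i j) ∘ₗ LinearMap.proj j

@[simp]
theorem matrixAction_apply {M : Type*} [AddCommGroup M] [Module K M] [Module L M]
    [IsScalarTower K L M] {p q : Type*} [Fintype p] (T : Matrix q p L) (v : p → M) (i : q) :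
    matrixAction K M T v i = ∑ j, T i j • v j := by
  simp [matrixAction]

/-- Every matrix over `L` has at least the rank on `M` that it has on `N`. For modules of the same
dimension this is the hom-order: `dim Hom(X, M) ≤ dim Hom(X, N)` for finitely presented `X`. -/
def RankDominates (L : Type*) [Ring L] [Algebra K L] (M N : Type*)
    [AddCommGroup M] [Module K M] [Module L M] [IsScalarTower K L M]
    [AddCommGroup N] [Module K N] [Module L N] [IsScalarTower K L N] : Prop :=
  ∀ (p q : Type) [Fintype p] [Fintype q] (T : Matrix q p L),
    finrank K (LinearMap.range (matrixAction K N T)) ≤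
      finrank K (LinearMap.range (matrixAction K M T))

/-- The elements of `M` annihilated by all members of the family `r`. -/
def torsionOf {n : ℕ} (r : Fin n → L) (M : Type*) [AddCommGroup M] [Module K M] [Module L M]
    [IsScalarTower K L M] : Submodule K M :=
  ⨅ i, LinearMap.ker (Algebra.lsmul K K M (r i))

variable {K}

theorem mem_torsionOf {n : ℕ} {r : Fin n → L} {M : Type*} [AddCommGroup M] [Module K M]
    [Module L M] [IsScalarTower K L M] {x : M} : x ∈ torsionOf K r M ↔ ∀ i, r i • x = 0 := by
  simp only [torsionOf, Submodule.mem_iInf, LinearMap.mem_ker, Algebra.lsmul_coe]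

theorem finrank_torsionOf_congr {n : ℕ} (r : Fin n → L) {M N : Type*}
    [AddCommGroup M] [Module K M] [Module L M] [IsScalarTower K L M]
    [AddCommGroup N] [Module K N] [Module L N] [IsScalarTower K L N] (e : M ≃ₗ[L] N) :
    finrank K (torsionOf K r M) = finrank K (torsionOf K r N) := by
  have : (torsionOf K r M).map (e.restrictScalars K).toLinearMap = torsionOf K r N := by
    ext x
    rw [Submodule.mem_map_equiv, mem_torsionOf, mem_torsionOf]
    refine forall_congr' fun i => ?_
    change r i • e.symm x = 0 ↔ _
    rw [← map_smul, map_eq_zero_iff _ e.symm.injective]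
  rw [← this]
  exact (LinearEquiv.finrank_map_eq (e.restrictScalars K) _).symm

/-- The submodule of a submodule `W` killed by the family `r` corresponds to `torsionOf K r M ⊓ W`. -/
theorem finrank_torsionOf_submodule {n : ℕ} (r : Fin n → L) {M : Type*}
    [AddCommGroup M] [Module K M] [Module L M] [IsScalarTower K L M] (W : Submodule L M) :
    finrank K (torsionOf K r W) = finrank K ↥(torsionOf K r M ⊓ W.restrictScalars K) := by
  have : (torsionOf K r W).map (W.subtype.restrictScalars K) =
      torsionOf K r M ⊓ W.restrictScalars K := by
    ext x
    constructor
    · rintro ⟨y, hy, rfl⟩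
      exact ⟨mem_torsionOf.2 fun i => congrArg Subtype.val (mem_torsionOf.1 hy i), y.2⟩
    · rintro ⟨h1, h2⟩
      exact ⟨⟨x, h2⟩, mem_torsionOf.2 fun i => Subtype.ext (mem_torsionOf.1 h1 i), rfl⟩
  rw [← this]
  exact (Submodule.equivMapOfInjective (W.subtype.restrictScalars K)
    W.subtype_injective (torsionOf K r W)).finrank_eq

variable {M N : Type*} [AddCommGroup M] [Module K M] [Module L M] [IsScalarTower K L M]
    [AddCommGroup N] [Module K N] [Module L N] [IsScalarTower K L N]

/-- The torsion is the kernel of the column `r`, so this is rank-nullity; an inequality of ranks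
becomes the reverse inequality of torsion dimensions. -/
theorem finrank_range_matrixAction_add_finrank_torsionOf [FiniteDimensional K M] {n : ℕ}
    (r : Fin n → L) :
    finrank K (LinearMap.range (matrixAction K M (Matrix.of fun (i : Fin n) (_ : Unit) => r i))) +
      finrank K (torsionOf K r M) = finrank K M := by
  let e : M ≃ₗ[K] (Unit → M) := (LinearEquiv.funUnique Unit K M).symm
  have he : ∀ x, e x () = x := fun x => rfl
  have hr := LinearMap.finrank_range_add_finrank_ker
    (matrixAction K M (Matrix.of fun (i : Fin n) (_ : Unit) => r i) ∘ₗ e.toLinearMap)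
  have hk : LinearMap.ker (matrixAction K M (Matrix.of fun (i : Fin n) (_ : Unit) => r i) ∘ₗ
      e.toLinearMap) = torsionOf K r M := by
    ext x
    rw [mem_torsionOf, LinearMap.mem_ker]
    constructor
    · intro hx i
      simpa [he] using congrFun hx i
    · intro hx
      ext i
      simpa [he] using hx i
  rwa [LinearMap.range_comp_of_range_eq_top _ (LinearEquiv.range e), hk] at hr

theorem RankDominates.finrank_torsionOf_le [FiniteDimensional K M] [FiniteDimensional K N]
    (h : RankDominates K L M N) (hdim : finrank K M = finrank K N) {n : ℕ} (r : Fin n → L) :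
    finrank K (torsionOf K r M) ≤ finrank K (torsionOf K r N) := by
  have hM := finrank_range_matrixAction_add_finrank_torsionOf (K := K) (M := M) r
  have hN := finrank_range_matrixAction_add_finrank_torsionOf (K := K) (M := N) r
  have := h Unit (Fin n) (Matrix.of fun i _ => r i)
  omega

/-- The submodule generated by the multiples of elements of `M` by elements of `I`. -/
def smulTop (I : Ideal L) (M : Type*) [AddCommGroup M] [Module L M] : Submodule L M :=
  Submodule.span L {y | ∃ x ∈ I, ∃ m : M, x • m = y}

theorem smul_mem_smulTop {I : Ideal L} {x : L} (hx : x ∈ I) (m : M) : x • m ∈ smulTop I M :=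
  Submodule.subset_span ⟨x, hx, m, rfl⟩

theorem le_annihilator_quotient_smulTop (I : Ideal L) :
    I ≤ annihilator L (M ⧸ smulTop I M) := fun x hx => by
  rw [mem_annihilator]
  rintro ⟨m⟩
  exact (Submodule.Quotient.mk_eq_zero _).2 (smul_mem_smulTop hx m)

/-- Scalars from `K` can be moved onto the module elements, and `l * r k` stays in the left ideal
`I`. So `I • M` is the image of the row matrix `r`, and a matrix acting on it can be composed with
this row. -/
theorem mem_smulTop_iff {I : Ideal L} {n : ℕ} {r : Fin n → L}
    (hr : Submodule.span K (Set.range r) = I.restrictScalars K) {y : M} :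
    y ∈ smulTop I M ↔ ∃ u : Fin n → M, ∑ k, r k • u k = y := by
  constructor
  · intro hy
    have hsmul : ∀ x ∈ I, ∀ m : M, ∃ u : Fin n → M, ∑ k, r k • u k = x • m := by
      intro x hx m
      have hx' : x ∈ Submodule.span K (Set.range r) := hr ▸ hx
      obtain ⟨c, rfl⟩ := (Submodule.mem_span_range_iff_exists_fun K).1 hx'
      exact ⟨fun k => c k • m, by
        rw [Finset.sum_smul]
        exact Finset.sum_congr rfl fun k _ => by
          rw [smul_assoc, ← smul_comm]⟩
    let φ : (Fin n → M) →ₗ[K] M := ∑ k, Algebra.lsmul K K M (r k) ∘ₗ LinearMap.proj k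
    have hφ : ∀ u, φ u = ∑ k, r k • u k := fun u => by simp [φ]
    have hr' : ∀ k, r k ∈ I := fun k =>
      (hr ▸ Submodule.subset_span (Set.mem_range_self k) : r k ∈ I.restrictScalars K)
    suffices y ∈ LinearMap.range φ from this.imp fun u hu => (hφ u).symm.trans hu
    induction hy using Submodule.span_induction with
    | mem y hy =>
      obtain ⟨x, hx, m, rfl⟩ := hy
      obtain ⟨u, hu⟩ := hsmul x hx m
      exact ⟨u, (hφ u).trans hu⟩
    | zero => exact zero_mem _
    | add y z _ _ hy hz => exact add_mem hy hz
    | smul l y _ hy =>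
      obtain ⟨u, rfl⟩ := hy
      rw [hφ, Finset.smul_sum]
      refine sum_mem fun k _ => ?_
      obtain ⟨v, hv⟩ := hsmul (l * r k) (I.mul_mem_left l (hr' k)) (u k)
      exact ⟨v, (hφ v).trans (hv.trans (mul_smul _ _ _))⟩
  · rintro ⟨u, rfl⟩
    have hr' : ∀ k, r k ∈ I := fun k =>
      (hr ▸ Submodule.subset_span (Set.mem_range_self k) : r k ∈ I.restrictScalars K)
    exact sum_mem fun k _ => smul_mem_smulTop (hr' k) _

/-- The rank of a matrix on `I • M` is the rank of a larger matrix on `M`. -/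
theorem finrank_range_matrixAction_smulTop {I : Ideal L} {n : ℕ} {r : Fin n → L}
    (hr : Submodule.span K (Set.range r) = I.restrictScalars K) {p q : Type*} [Fintype p]
    (T : Matrix q p L) :
    finrank K (LinearMap.range (matrixAction K (smulTop I M) T)) =
      finrank K (LinearMap.range (matrixAction K M
        (Matrix.of fun (i : q) (jk : p × Fin n) => T i jk.1 * r jk.2))) := by
  let ι : (q → smulTop I M) →ₗ[K] (q → M) :=
    LinearMap.compLeft ((smulTop I M).restrictScalars K).subtype q
  have hι : Function.Injective ι := fun v w h => by
    ext i
    exact congrFun h i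
  have : (LinearMap.range (matrixAction K (smulTop I M) T)).map ι =
      LinearMap.range (matrixAction K M (Matrix.of fun (i : q) (jk : p × Fin n) => T i jk.1 * r jk.2)) := by
    have hval : ∀ (v : p → smulTop I M) (i : q),
        ι (matrixAction K (smulTop I M) T v) i = ∑ j, T i j • (v j : M) := fun v i => by
      change ((matrixAction K (smulTop I M) T v i : smulTop I M) : M) = _
      rw [matrixAction_apply]
      simp
    ext y
    constructor
    · rintro ⟨_, ⟨v, rfl⟩, rfl⟩
      choose u hu using fun j => (mem_smulTop_iff hr).1 (v j).2
      refine ⟨fun jk => u jk.1 jk.2, ?_⟩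
      ext i
      rw [hval, matrixAction_apply, Fintype.sum_prod_type]
      simp only [Matrix.of_apply]
      refine Finset.sum_congr rfl fun j _ => ?_
      rw [← hu j, Finset.smul_sum]
      exact Finset.sum_congr rfl fun k _ => mul_smul _ _ _
    · rintro ⟨u, rfl⟩
      refine ⟨_, ⟨fun j => ⟨∑ k, r k • u (j, k), (mem_smulTop_iff hr).2 ⟨_, rfl⟩⟩, rfl⟩, ?_⟩
      ext i
      rw [hval, matrixAction_apply, Fintype.sum_prod_type]
      simp only [Matrix.of_apply]
      refine Finset.sum_congr rfl fun j _ => ?_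
      rw [Finset.smul_sum]
      exact Finset.sum_congr rfl fun k _ => (mul_smul _ _ _).symm
  rw [← this]
  exact (Submodule.equivMapOfInjective ι hι _).finrank_eq

theorem exists_fin_span_eq [FiniteDimensional K L] (I : Ideal L) :
    ∃ (n : ℕ) (r : Fin n → L), Submodule.span K (Set.range r) = I.restrictScalars K :=
  Submodule.fg_iff_exists_fin_generating_family.1 (IsNoetherian.noetherian _)

theorem RankDominates.rankDominates_smulTop [FiniteDimensional K L] (h : RankDominates K L M N) (I : Ideal L) :
    RankDominates K L (smulTop I M) (smulTop I N) := fun p q _ _ T => by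
  obtain ⟨n, r, hr⟩ := exists_fin_span_eq (K := K) I
  rw [finrank_range_matrixAction_smulTop hr, finrank_range_matrixAction_smulTop hr]
  exact h _ _ _

theorem finrank_range_matrixAction_one (M : Type*) [AddCommGroup M] [Module K M] [Module L M]
    [IsScalarTower K L M] :
    finrank K (LinearMap.range (matrixAction K M (1 : Matrix Unit Unit L))) = finrank K M := by
  have : LinearMap.range (matrixAction K M (1 : Matrix Unit Unit L)) = ⊤ :=
    LinearMap.range_eq_top.2 fun v => ⟨v, by ext i; simp⟩
  rw [this, finrank_top, (LinearEquiv.funUnique Unit K M).finrank_eq]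

theorem RankDominates.finrank_le (h : RankDominates K L M N) : finrank K N ≤ finrank K M := by
  have := h Unit Unit 1
  rwa [finrank_range_matrixAction_one, finrank_range_matrixAction_one] at this

theorem finrank_quotient_add_finrank_of_tower [FiniteDimensional K M] (W : Submodule L M) :
    finrank K (M ⧸ W) + finrank K W = finrank K M := by
  rw [← Submodule.finrank_quotient_add_finrank (W.restrictScalars K),
    (Submodule.Quotient.restrictScalarsEquiv K W).finrank_eq]
  rfl

end RankOrder

/-! ### Uniserial modules are determined by rank inequalities -/

section Uniserial

variable {K L : Type*} [Field K] [Ring L] [Algebra K L]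

/-- Two cyclic modules of the same dimension are isomorphic if the annihilator of a generator of the
first one kills a generator of the second one. -/
theorem nonempty_linearEquiv_of_span_singleton_eq_top (K : Type*) {L M N : Type*} [Field K] [Ring L]
    [Algebra K L] [AddCommGroup M] [Module K M] [Module L M] [IsScalarTower K L M]
    [AddCommGroup N] [Module K N] [Module L N] [IsScalarTower K L N]
    [FiniteDimensional K M] [FiniteDimensional K N] (hdim : finrank K M = finrank K N)
    {u : M} {x : N} (hu : (L ∙ u) = ⊤) (hx : (L ∙ x) = ⊤)
    (hux : ∀ a : L, a • u = 0 → a • x = 0) : Nonempty (M ≃ₗ[L] N) := by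
  let f := LinearMap.toSpanSingleton L M u
  have hf : Function.Surjective f :=
    LinearMap.range_eq_top.1 ((LinearMap.range_toSpanSingleton u).trans hu)
  have hker : LinearMap.ker f ≤ LinearMap.ker (LinearMap.toSpanSingleton L N x) :=
    fun a ha => hux a ha
  let g : M →ₗ[L] N := (LinearMap.ker f).liftQ (LinearMap.toSpanSingleton L N x) hker ∘ₗ
    (f.quotKerEquivOfSurjective hf).symm.toLinearMap
  have hg : Function.Surjective g := by
    rw [← LinearMap.range_eq_top, LinearMap.range_comp, LinearEquiv.range, Submodule.map_top,
      Submodule.range_liftQ, LinearMap.range_toSpanSingleton, hx]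
  exact ⟨LinearEquiv.ofBijective g ⟨(LinearMap.injective_iff_surjective_of_finrank_eq_finrank
    (f := g.restrictScalars K) hdim).2 hg, hg⟩⟩

/-- A uniserial module is determined, among uniserial modules of the same dimension, by the ranks
of the matrices over `L`, and inequalities between these ranks suffice. -/
theorem RankDominates.nonempty_linearEquiv [FiniteDimensional K L] {M N : Type*}
    [AddCommGroup M] [Module K M] [Module L M] [IsScalarTower K L M]
    [AddCommGroup N] [Module K N] [Module L N] [IsScalarTower K L N]
    [FiniteDimensional K M] [FiniteDimensional K N] (h : RankDominates K L M N)
    (hM : IsUniserial L M) (hN : IsUniserial L N) (hdim : finrank K M = finrank K N) :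
    Nonempty (M ≃ₗ[L] N) := by
  induction hn : finrank K M using Nat.strong_induction_on generalizing M N with
  | _ n ih =>
  subst hn
  rcases subsingleton_or_nontrivial M with hsub | hnt
  · have : Subsingleton N := finrank_zero_iff.1 (hdim.symm.trans (finrank_zero_iff.2 hsub))
    exact ⟨0⟩
  have : Module.Finite L M := Module.Finite.of_restrictScalars_finite K L M
  obtain ⟨P, hP, -⟩ := (eq_top_or_exists_le_coatom (⊥ : Submodule L M)).resolve_left bot_ne_top
  have hS : IsSimpleModule L (M ⧸ P) := isSimpleModule_iff_isCoatom.2 hP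
  have : FiniteDimensional K (M ⧸ P) :=
    Module.Finite.of_surjective (P.mkQ.restrictScalars K) P.mkQ_surjective
  let I : Ideal L := annihilator L (M ⧸ P)
  have hMP : smulTop I M ≤ P := by
    refine Submodule.span_le.2 ?_
    rintro _ ⟨x, hx, m, rfl⟩
    exact (Submodule.Quotient.mk_eq_zero P).1 (mem_annihilator.1 hx (Submodule.Quotient.mk m))
  have hMtop : smulTop I M ≠ ⊤ := fun h0 => hP.1 (top_le_iff.1 (h0 ▸ hMP))
  have hqM := finrank_quotient_add_finrank_of_tower (K := K) (smulTop I M)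
  have hqN := finrank_quotient_add_finrank_of_tower (K := K) (smulTop I N)
  have := Submodule.Quotient.nontrivial_iff.2 hMtop
  obtain ⟨eM⟩ := IsUniserial.nonempty_linearEquiv_of_annihilator_le K
    (hM.of_surjective _ (smulTop I M).mkQ_surjective) (S := M ⧸ P) (le_annihilator_quotient_smulTop I)
  have hlt : finrank K (smulTop I M) < finrank K M :=
    Submodule.finrank_lt (s := (smulTop I M).restrictScalars K) (by simpa using hMtop)
  have hle : finrank K (smulTop I N) ≤ finrank K (smulTop I M) := (h.rankDominates_smulTop I).finrank_le
  -- `dim IN ≤ dim IM < dim M = dim N`, so `N` has a nonzero quotient killed by `I`, which makes its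
  -- top `S` as well.
  have hNtop : smulTop I N ≠ ⊤ := fun h0 => by
    rw [h0] at hle
    have : finrank K (⊤ : Submodule L N) = finrank K N :=
      (Submodule.topEquiv.restrictScalars K).finrank_eq
    omega
  have := Submodule.Quotient.nontrivial_iff.2 hNtop
  obtain ⟨eN⟩ := IsUniserial.nonempty_linearEquiv_of_annihilator_le K
    (hN.of_surjective _ (smulTop I N).mkQ_surjective) (S := M ⧸ P) (le_annihilator_quotient_smulTop I)
  have heM := (eM.restrictScalars K).finrank_eq
  have heN := (eN.restrictScalars K).finrank_eq
  have hcM : IsCoatom (smulTop I M) :=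
    isSimpleModule_iff_isCoatom.1 (IsSimpleModule.congr eM)
  have hcN : IsCoatom (smulTop I N) :=
    isSimpleModule_iff_isCoatom.1 (IsSimpleModule.congr eN)
  have : FiniteDimensional K (smulTop I M) :=
    inferInstanceAs (FiniteDimensional K ((smulTop I M).restrictScalars K))
  have : FiniteDimensional K (smulTop I N) :=
    inferInstanceAs (FiniteDimensional K ((smulTop I N).restrictScalars K))
  obtain ⟨e⟩ := ih _ hlt (h.rankDominates_smulTop I) (hM.of_injective _ (smulTop I M).subtype_injective)
    (hN.of_injective _ (smulTop I N).subtype_injective) (by omega) rfl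
  by_contra hne
  obtain ⟨u, hu⟩ : ∃ u, u ∉ smulTop I M := by
    by_contra! hall
    exact hMtop (eq_top_iff.2 fun u _ => hall u)
  have hutop := hM.span_singleton_eq_top hcM hu
  -- The test family: finitely many elements spanning the annihilator of the generator `u`.
  obtain ⟨n, r, hr⟩ := exists_fin_span_eq (K := K) (LinearMap.ker (LinearMap.toSpanSingleton L M u))
  have hut : u ∈ torsionOf K r M := mem_torsionOf.2 fun i =>
    (hr ▸ Submodule.subset_span (Set.mem_range_self i) :
      r i ∈ (LinearMap.ker (LinearMap.toSpanSingleton L M u)).restrictScalars K)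
  have hNle : torsionOf K r N ≤ (smulTop I N).restrictScalars K := fun x hx => by
    by_contra hxN
    refine hne (nonempty_linearEquiv_of_span_singleton_eq_top K hdim hutop
      (hN.span_singleton_eq_top hcN hxN) fun a ha => ?_)
    have ha' : a ∈ Submodule.span K (Set.range r) := hr ▸ ha
    obtain ⟨c, rfl⟩ := (Submodule.mem_span_range_iff_exists_fun K).1 ha'
    rw [Finset.sum_smul]
    exact Finset.sum_eq_zero fun i _ => by
      rw [smul_assoc, mem_torsionOf.1 hx i, smul_zero]
  have h1 : finrank K ↥(torsionOf K r M ⊓ (smulTop I M).restrictScalars K) <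
      finrank K (torsionOf K r M) :=
    Submodule.finrank_lt_finrank_of_lt (lt_of_le_of_ne inf_le_left fun heq => hu
      (heq.symm ▸ hut : u ∈ torsionOf K r M ⊓ (smulTop I M).restrictScalars K).2)
  have h2 := finrank_torsionOf_submodule (K := K) r (smulTop I M)
  have h3 := finrank_torsionOf_submodule (K := K) r (smulTop I N)
  rw [inf_eq_left.2 hNle] at h3
  have h4 := finrank_torsionOf_congr (K := K) r e
  have h5 := h.finrank_torsionOf_le hdim r
  -- With `t` the dimension of the torsion, `t(N) = t(IN) = t(IM) < t(M) ≤ t(N)`.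
  omega

end Uniserial

end ModuleVariety

namespace ModuleVariety

open Matrix

/-! ### Lower semicontinuity of rank under degeneration -/

section Semicontinuity

variable {K ι : Type*} [Field K] {d : ℕ}

/-- The functions on the affine space of points that are polynomials in the matrix entries. -/
noncomputable def polynomialFunctions (K ι : Type*) [Field K] (d : ℕ) : Subalgebra K (Pt K ι d → K) :=
  (AlgHom.pi fun x : Pt K ι d => MvPolynomial.aeval (R := K) (coords x)).range

theorem exists_ne_zero_of_mem_zariskiClosure {S : Set (Pt K ι d)} {y : Pt K ι d}
    (hy : y ∈ zariskiClosure S) {f : Pt K ι d → K} (hf : f ∈ polynomialFunctions K ι d)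
    (hne : f y ≠ 0) : ∃ z ∈ S, f z ≠ 0 := by
  obtain ⟨P, rfl⟩ := hf
  by_contra! hz
  refine hne (hy P ?_)
  rintro _ ⟨z, hzS, rfl⟩
  exact hz z hzS

/-- The matrix by which an element of the free algebra acts at the point `x`. -/
noncomputable def evalAt (x : Pt K ι d) : FreeAlgebra K ι →ₐ[K] Matrix (Fin d) (Fin d) K :=
  FreeAlgebra.lift K x

theorem evalAt_apply_mem_polynomialFunctions (f : FreeAlgebra K ι) (s t : Fin d) :
    (fun x : Pt K ι d => evalAt x f s t) ∈ polynomialFunctions K ι d := by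
  induction f generalizing s t with
  | grade0 c =>
    simp only [AlgHom.commutes, Matrix.algebraMap_matrix_apply]
    exact (polynomialFunctions K ι d).algebraMap_mem (if s = t then c else 0)
  | grade1 i =>
    refine ⟨MvPolynomial.X (i, s, t), ?_⟩
    ext x
    simp [evalAt, coords]
  | mul f g hf hg =>
    simp only [map_mul, Matrix.mul_apply]
    have : (fun x : Pt K ι d => ∑ k, evalAt x f s k * evalAt x g k t) =
      ∑ k, (fun x : Pt K ι d => evalAt x f s k) * (fun x : Pt K ι d => evalAt x g k t) := by
      ext x; simp
    rw [this]
    exact sum_mem fun k _ => mul_mem (hf s k) (hg k t)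
  | add f g hf hg =>
    simp only [map_add, Matrix.add_apply]
    exact add_mem (hf s t) (hg s t)

/-- The linear map `(K ^ d) ^ p → (K ^ d) ^ q` by which a matrix over the free algebra acts at the
point `x`. -/
noncomputable def blockMap {p q : Type*} [Fintype p] (F : Matrix q p (FreeAlgebra K ι))
    (x : Pt K ι d) : (p → Fin d → K) →ₗ[K] (q → Fin d → K) :=
  LinearMap.pi fun i => ∑ j, (evalAt x (F i j)).mulVecLin ∘ₗ LinearMap.proj j

theorem blockMap_apply {p q : Type*} [Fintype p] (F : Matrix q p (FreeAlgebra K ι))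
    (x : Pt K ι d) (v : p → Fin d → K) (i : q) :
    blockMap F x v i = ∑ j, evalAt x (F i j) *ᵥ v j := by
  simp [blockMap]

theorem blockMap_apply_mem_polynomialFunctions {p q : Type*} [Fintype p]
    (F : Matrix q p (FreeAlgebra K ι)) (v : p → Fin d → K) (i : q) (s : Fin d) :
    (fun x : Pt K ι d => blockMap F x v i s) ∈ polynomialFunctions K ι d := by
  have : (fun x : Pt K ι d => blockMap F x v i s) =
      ∑ j, ∑ t, v j t • (fun x : Pt K ι d => evalAt x (F i j) s t) := by
    ext x
    simp [blockMap_apply, Matrix.mulVec, dotProduct, mul_comm]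
  rw [this]
  exact sum_mem fun j _ => sum_mem fun t _ =>
    (polynomialFunctions K ι d).smul_mem (evalAt_apply_mem_polynomialFunctions _ _ _) _

theorem comp_blockMap_apply_mem_polynomialFunctions {p q : Type*} [Fintype p] [Fintype q]
    (F : Matrix q p (FreeAlgebra K ι)) (φ : (q → Fin d → K) →ₗ[K] K) (v : p → Fin d → K) :
    (fun x : Pt K ι d => φ (blockMap F x v)) ∈ polynomialFunctions K ι d := by
  classical
  let b := Pi.basis fun _ : q => Pi.basisFun K (Fin d)
  have : (fun x : Pt K ι d => φ (blockMap F x v)) =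
      ∑ k, φ (b k) • (fun x : Pt K ι d => blockMap F x v k.1 k.2) := by
    ext x
    conv_lhs => rw [← b.sum_repr (blockMap F x v)]
    simp [b, mul_comm]
  rw [this]
  exact sum_mem fun k _ =>
    (polynomialFunctions K ι d).smul_mem (blockMap_apply_mem_polynomialFunctions _ _ _ _) _

theorem det_mem_polynomialFunctions {r : ℕ} (A : Pt K ι d → Matrix (Fin r) (Fin r) K)
    (hA : ∀ i j, (fun x => A x i j) ∈ polynomialFunctions K ι d) :
    (fun x => (A x).det) ∈ polynomialFunctions K ι d := by
  have : (fun x => (A x).det) = ∑ σ : Equiv.Perm (Fin r),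
      (σ.sign : ℤ) • ∏ i, (fun x => A x (σ i) i) := by
    ext x
    simp [Matrix.det_apply, Units.smul_def]
  rw [this]
  exact sum_mem fun σ _ => zsmul_mem (prod_mem fun i _ => hA _ _) _

/-- A linear map of rank `r` between vector spaces restricts and corestricts to an isomorphism of
`r`-dimensional spaces. -/
theorem exists_comp_comp_eq_id {V W : Type*} [AddCommGroup V] [Module K V] [AddCommGroup W]
    [Module K W] [FiniteDimensional K W] (f : V →ₗ[K] W) :
    ∃ (α : (Fin (finrank K (LinearMap.range f)) → K) →ₗ[K] V)
      (β : W →ₗ[K] (Fin (finrank K (LinearMap.range f)) → K)), β ∘ₗ f ∘ₗ α = LinearMap.id := by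
  let e := (finBasis K (LinearMap.range f)).equivFun
  obtain ⟨g, hg⟩ := LinearMap.exists_rightInverse_of_surjective f.rangeRestrict f.range_rangeRestrict
  obtain ⟨π, hπ⟩ := LinearMap.exists_leftInverse_of_injective (LinearMap.range f).subtype
    (LinearMap.range f).ker_subtype
  refine ⟨g ∘ₗ e.symm.toLinearMap, e.toLinearMap ∘ₗ π, LinearMap.ext fun v => ?_⟩
  have h1 : f (g (e.symm v)) = (LinearMap.range f).subtype (e.symm v) :=
    congrArg Subtype.val (LinearMap.congr_fun hg (e.symm v))
  have h2 := LinearMap.congr_fun hπ (e.symm v)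
  simp only [LinearMap.comp_apply, LinearEquiv.coe_coe, LinearMap.id_apply] at h2 ⊢
  rw [h1, h2, LinearEquiv.apply_symm_apply]

/-- An invertible compression of `f` to an `r`-dimensional space factors through the range of `f`.
-/
theorem le_finrank_range_of_det_ne_zero {V W : Type*} [AddCommGroup V] [Module K V]
    [AddCommGroup W] [Module K W] [FiniteDimensional K W] {r : ℕ} (f : V →ₗ[K] W)
    (α : (Fin r → K) →ₗ[K] V) (β : W →ₗ[K] (Fin r → K))
    (h : (LinearMap.toMatrix' (β ∘ₗ f ∘ₗ α)).det ≠ 0) : r ≤ finrank K (LinearMap.range f) := by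
  have hu : IsUnit (β ∘ₗ f ∘ₗ α) := by
    rw [← LinearMap.isUnit_toMatrix'_iff, Matrix.isUnit_iff_isUnit_det]
    exact h.isUnit
  have htop : LinearMap.range (β ∘ₗ f ∘ₗ α) = ⊤ := (LinearMap.isUnit_iff_range_eq_top _).1 hu
  have hle : LinearMap.range (β ∘ₗ f ∘ₗ α) ≤ (LinearMap.range f).map β := by
    rintro _ ⟨v, rfl⟩
    exact ⟨_, ⟨α v, rfl⟩, rfl⟩
  calc r = finrank K (LinearMap.range (β ∘ₗ f ∘ₗ α)) := by rw [htop]; simp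
    _ ≤ finrank K ((LinearMap.range f).map β) := Submodule.finrank_mono hle
    _ ≤ _ := Submodule.finrank_map_le _ _

/-- The rank of `blockMap F` is lower semicontinuous. -/
theorem exists_finrank_range_blockMap_le {S : Set (Pt K ι d)} {y : Pt K ι d}
    (hy : y ∈ zariskiClosure S) {p q : Type*} [Fintype p] [Fintype q]
    (F : Matrix q p (FreeAlgebra K ι)) : ∃ z ∈ S,
    finrank K (LinearMap.range (blockMap F y)) ≤ finrank K (LinearMap.range (blockMap F z)) := by
  -- `α` and `β` are chosen at `y` and then kept fixed. The determinant of the compression is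
  -- polynomial in the point and equals 1 at `y`, so it is nonzero somewhere on `S`.
  obtain ⟨α, β, h⟩ := exists_comp_comp_eq_id (blockMap F y)
  obtain ⟨z, hz, hne⟩ := exists_ne_zero_of_mem_zariskiClosure hy
    (f := fun x => (LinearMap.toMatrix' (β ∘ₗ blockMap F x ∘ₗ α)).det)
    (det_mem_polynomialFunctions _ fun i j =>
      comp_blockMap_apply_mem_polynomialFunctions F (LinearMap.proj i ∘ₗ β) (α (Pi.single j 1)))
    (by simp [h])
  exact ⟨z, hz, le_finrank_range_of_det_ne_zero _ α β hne⟩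

theorem Represents.of_mem_orbit {L : Type*} [Ring L] [Algebra K L] {a : ι → L}
    {M : Type*} [AddCommGroup M] [Module K M] [Module L M] {x z : Pt K ι d} (h : Represents a x M)
    (hz : z ∈ orbit x) : Represents a z M := by
  obtain ⟨φ, hφ⟩ := h
  obtain ⟨g, hg⟩ := hz
  have h1 : (g : Matrix (Fin d) (Fin d) K) * (g⁻¹ : GL (Fin d) K) = 1 := g.mul_inv
  have h2 : ((g⁻¹ : GL (Fin d) K) : Matrix (Fin d) (Fin d) K) * g = 1 := g.inv_mul
  let e : (Fin d → K) ≃ₗ[K] (Fin d → K) :=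
    LinearEquiv.ofLinearMap ((g⁻¹ : GL (Fin d) K) : Matrix (Fin d) (Fin d) K).mulVecLin
      (g : Matrix (Fin d) (Fin d) K).mulVecLin
      (by rw [← Matrix.mulVecLin_mul, h2, Matrix.mulVecLin_one])
      (by rw [← Matrix.mulVecLin_mul, h1, Matrix.mulVecLin_one])
  have he : ∀ v, e v = ((g⁻¹ : GL (Fin d) K) : Matrix (Fin d) (Fin d) K) *ᵥ v := fun _ => rfl
  refine ⟨e.trans φ, fun i v => ?_⟩
  rw [LinearEquiv.trans_apply, LinearEquiv.trans_apply, ← hφ, he, he, hg, Matrix.mulVec_mulVec,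
    Matrix.mulVec_mulVec, ← mul_assoc, ← mul_assoc, h2, one_mul]

variable {L : Type*} [Ring L] [Algebra K L] {a : ι → L} {M : Type*} [AddCommGroup M] [Module K M]
  [Module L M] [IsScalarTower K L M]

/-- Links the two actions: elements of `L` are lifted to noncommutative polynomials, whose action is
polynomial in the point. -/
theorem apply_evalAt_mulVec {x : Pt K ι d} {φ : (Fin d → K) ≃ₗ[K] M}
    (hφ : ∀ (i : ι) (v : Fin d → K), φ (x i *ᵥ v) = a i • φ v) (f : FreeAlgebra K ι)
    (v : Fin d → K) : φ (evalAt x f *ᵥ v) = FreeAlgebra.lift K a f • φ v := by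
  induction f generalizing v with
  | grade0 c =>
    rw [AlgHom.commutes, AlgHom.commutes, algebraMap_smul, Algebra.algebraMap_eq_smul_one,
      Matrix.smul_mulVec, Matrix.one_mulVec, map_smul]
  | grade1 i => simpa [evalAt] using hφ i v
  | mul f g hf hg => rw [map_mul, map_mul, ← Matrix.mulVec_mulVec, hf, hg, mul_smul]
  | add f g hf hg => rw [map_add, map_add, Matrix.add_mulVec, map_add, hf, hg, add_smul]

theorem Represents.finrank_range_blockMap {x : Pt K ι d} (h : Represents a x M) {p q : Type*}
    [Fintype p] (F : Matrix q p (FreeAlgebra K ι)) :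
    finrank K (LinearMap.range (blockMap F x)) =
      finrank K (LinearMap.range (matrixAction K M (F.map (FreeAlgebra.lift K a)))) := by
  obtain ⟨φ, hφ⟩ := h
  let φp := LinearEquiv.piCongrRight fun _ : p => φ
  let φq := LinearEquiv.piCongrRight fun _ : q => φ
  have hcomm : φq.toLinearMap ∘ₗ blockMap F x =
      matrixAction K M (F.map (FreeAlgebra.lift K a)) ∘ₗ φp.toLinearMap := by
    refine LinearMap.ext fun v => funext fun i => ?_
    change φ (blockMap F x v i) = matrixAction K M (F.map (FreeAlgebra.lift K a)) (φp v) i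
    rw [blockMap_apply, matrixAction_apply, map_sum]
    exact Finset.sum_congr rfl fun j _ => apply_evalAt_mulVec hφ _ _
  rw [← LinearMap.range_comp_of_range_eq_top _ (LinearEquiv.range φp), ← hcomm,
    LinearMap.range_comp]
  exact (LinearEquiv.finrank_map_eq φq _).symm

theorem Degenerates.rankDominates (ha : Algebra.adjoin K (Set.range a) = ⊤) {N : Type*}
    [AddCommGroup N] [Module K N] [Module L N] [IsScalarTower K L N]
    (h : Degenerates K a M N) : RankDominates K L M N := fun p q _ _ T => by
  obtain ⟨d, x, y, -, -, hx, hy, hxy⟩ := h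
  have hsurj : Function.Surjective (FreeAlgebra.lift K a) := by
    rw [← AlgHom.range_eq_top, ← Algebra.adjoin_range_eq_range_freeAlgebra_lift, ha]
  choose s hs using hsurj
  have hT : (T.map s).map (FreeAlgebra.lift K a) = T := by
    ext i j
    exact hs _
  -- The point `z` lies in the orbit of `x`, so it still represents `M`.
  obtain ⟨z, hz, hle⟩ := exists_finrank_range_blockMap_le hxy (T.map s)
  rwa [hy.finrank_range_blockMap, (hx.of_mem_orbit hz).finrank_range_blockMap, hT] at hle

end Semicontinuity

end ModuleVariety

theorem propositionE {K : Type*} [Field K] [IsAlgClosed K]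
    {L : Type*} [Ring L] [Algebra K L] [FiniteDimensional K L]
    {ι : Type*} [Finite ι] (a : ι → L) (ha : Algebra.adjoin K (Set.range a) = ⊤)
    (U U' : Type*)
    [AddCommGroup U] [Module K U] [Module L U] [IsScalarTower K L U] [FiniteDimensional K U]
    [AddCommGroup U'] [Module K U'] [Module L U'] [IsScalarTower K L U'] [FiniteDimensional K U']
    (hU : IsUniserial L U) (hU' : IsUniserial L U')
    (hdim : Module.finrank K U = Module.finrank K U')
    (hne : IsEmpty (U ≃ₗ[L] U')) :
    ¬ ModuleVariety.Degenerates K a U U' := by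
  intro h
  obtain ⟨e⟩ := (h.rankDominates ha).nonempty_linearEquiv hU hU' hdim
  exact hne.false e
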